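/- Let $\mathcal I,\mathcal O$ be disjoint finite sets of Boolean variables, of sizes $m,n$, put $X=\mathcal I\cup\mathcal O$, and let $N=|2^{X}|=2^{m+n}$ be the number of states. A game structure $(\mathcal I,\mathcal O,\theta_{\mathcal I},\theta_{\mathcal O},\rho_{\mathcal I},\rho_{\mathcal O})$ consists of assertions $\theta_{\mathcal I}$ over $\mathcal I$, $\theta_{\mathcal O}$ over $\mathcal I\cup\mathcal O$, $\rho_{\mathcal I}$ over $X\cup\mathcal I'$ and $\rho_{\mathcal O}$ over $X\cup X'$; no separation of variables is assumed. The environment picks an initial input $i\models\theta_{\mathcal I}$ and the system an initial output $o$ with $(i,o)\models\theta_{\mathcal O}$; then, from state $s$, the environment repeatedly picks an input $i$ with $(s,i')\models\rho_{\mathcal I}$ and the system answers with an output $o$ such that $(s,(i,o)')\models\rho_{\mathcal O}$, and the play moves to $(i,o)$. A player who has no legal move loses; the system wins an infinite play iff it visits states satisfying $\mathit{acc}$ infinitely often. The game graph has the states as vertices and an edge from $s$ to $t=(i,o)$ iff $(s,i')\models\rho_{\mathcal I}$ and $(s,t')\models\rho_{\mathcal O}$. The game is a weak Büchi game if each strongly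 connected component of the game graph either consists of states satisfying $\mathit{acc}$ only or contains no such state. The winning region is the set of states from which the system has a (possibly history-dependent) winning strategy; the game is realizable if the system has a strategy whose initial outputs and later moves win against every initial input and every behaviour of the environment. A memoryless strategy consists of a choice $g(i)=o$ of initial outputs and a function $f(s,i)=o$; it is represented by the assertions $D(X)$ with $(i,o)\models D$ iff $g(i)=o$, and $F(X,X')$ with $(s,(i,o)')\models F$ iff $f(s,i)=o$. A symbolic program has registers holding BDDs over a fixed number of copies $X,X',X''$ of the variables, and a finite text (sequencing, conditionals, loops, counters) that depends neither on the game nor on $m,n$. Its symbolic operations are $\neg,\vee,\wedge,\rightarrow$, the quantifiers $\exists\mathcal V,\forall\mathcal V$ over the input or the output variables of one copy, and the formation of the BDDs of a single variable and of the equality of the inputs, or of the outputs, of two copies; it may also test two BDDs for equality. Each of these operations, each test and each operation on a counter is one step. Theorem. Realizability and synthesis of memoryless winning strategies for weak Büchi games can be done in $O(N)$ symbolic operations. That is, there are one symbolic program and one constant $C$ such that, for all $m,n$ and every weak Büchi game over $m$ input and $n$ output variables, the program, started on the BDDs of $\theta_{\mathcal I},\theta_{\mathcal O},\rho_{\mathcal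 I},\rho_{\mathcal O},\mathit{acc}$, halts after at most $C\cdot N$ steps with: (a) a BDD over $X$ representing exactly the winning region of the system; (b) the BDD $\mathit{true}$ if the game is realizable, and the BDD $\mathit{false}$ otherwise; (c) BDDs $F(X,X')$ and $D(X)$ representing a memoryless strategy $(f,g)$ that wins from every state of the winning region and that, if the game is realizable, is a winning strategy for the game. -/

import Mathlib

namespace WeakBuchi

/-! ### Games over Boolean variables

`m` input variables (controlled by the environment) and `n` output variables (controlled by the
system).  A state is a valuation of all of them. -/

/-- Valuations of the input variables. -/
abbrev Input (m : ℕ) := Fin m → Bool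

/-- Valuations of the output variables. -/
abbrev Output (n : ℕ) := Fin n → Bool

/-- States: valuations of all the variables. -/
abbrev State (m n : ℕ) := Input m × Output n

/-- A game structure: the initial assumption over the inputs, the initial guarantee over inputs and
outputs, the safety assumption over state and next input, and the safety guarantee over state and
next state.  No separation of variables is required. -/
structure GameStructure (m n : ℕ) where
  initIn : Set (Input m)
  initOut : Set (State m n)
  safeIn : State m n → Input m → Prop
  safeOut : State m n → State m n → Prop

/-- Edges of the game graph. -/
def GameStructure.Edge {m n : ℕ} (G : GameStructure m n) (s t : State m n) : Prop :=
  G.safeIn s t.1 ∧ G.safeOut s t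

/-- `s` and `t` lie in the same strongly connected component of the game graph. -/
def GameStructure.SameSCC {m n : ℕ} (G : GameStructure m n) (s t : State m n) : Prop :=
  Relation.ReflTransGen G.Edge s t ∧ Relation.ReflTransGen G.Edge t s

/-- The game with winning condition `GF acc` is a weak Büchi game: every strongly connected
component consists of accepting states only or of non-accepting states only. -/
def GameStructure.IsWeak {m n : ℕ} (G : GameStructure m n) (acc : Set (State m n)) : Prop :=
  ∀ s t, G.SameSCC s t → (s ∈ acc ↔ t ∈ acc)

/-- A strategy of the system picks an output from the finite sequence of states visited so far and
the new input.  On the empty sequence it picks the initial output. -/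
abbrev Strategy (m n : ℕ) := List (State m n) → Input m → Output n

/-- The states visited at times `0, …, k`. -/
def history {m n : ℕ} (p : ℕ → State m n) (k : ℕ) : List (State m n) :=
  (List.range (k + 1)).map p

/-- Step `k` of `p` is a legal move of the environment answered by the strategy `f`. -/
def GameStructure.ConsistentAt {m n : ℕ} (G : GameStructure m n) (f : Strategy m n)
    (p : ℕ → State m n) (k : ℕ) : Prop :=
  G.safeIn (p k) (p (k + 1)).1 ∧ (p (k + 1)).2 = f (history p k) (p (k + 1)).1

/-- `f` wins the game with condition `GF acc` from the state `s`: after every finite play from `s`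
consistent with `f`, the answer of `f` to every legal input is legal, and every infinite play
from `s` consistent with `f` visits `acc` infinitely often.  (So a play that ends because the
environment has no legal input is won by the system, and one that ends because the system has no
legal output is lost.) -/
def GameStructure.WinsFrom {m n : ℕ} (G : GameStructure m n) (acc : Set (State m n))
    (f : Strategy m n) (s : State m n) : Prop :=
  (∀ (p : ℕ → State m n) (k : ℕ), p 0 = s → (∀ j < k, G.ConsistentAt f p j) →
      ∀ i : Input m, G.safeIn (p k) i → G.safeOut (p k) (i, f (history p k) i)) ∧
  (∀ p : ℕ → State m n, p 0 = s → (∀ j, G.ConsistentAt f p j) → ∀ k, ∃ j, k ≤ j ∧ p j ∈ acc)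

/-- The winning region of the system. -/
def GameStructure.winningRegion {m n : ℕ} (G : GameStructure m n) (acc : Set (State m n)) :
    Set (State m n) :=
  {s | ∃ f : Strategy m n, G.WinsFrom acc f s}

/-- `f` is a winning strategy: it answers every initial input by a legal initial output and wins
from the resulting state. -/
def GameStructure.IsWinning {m n : ℕ} (G : GameStructure m n) (acc : Set (State m n))
    (f : Strategy m n) : Prop :=
  ∀ i ∈ G.initIn, (i, f [] i) ∈ G.initOut ∧ G.WinsFrom acc f (i, f [] i)

/-- The game is realizable. -/
def GameStructure.Realizable {m n : ℕ} (G : GameStructure m n) (acc : Set (State m n)) : Prop :=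
  ∃ f : Strategy m n, G.IsWinning acc f

/-- The memoryless strategy with initial outputs `g` that plays `f s i` in state `s` on input
`i`. -/
def memoryless {m n : ℕ} (g : Input m → Output n) (f : State m n → Input m → Output n) :
    Strategy m n :=
  fun h i => match h.getLast? with
    | none => g i
    | some s => f s i

/-! ### Symbolic algorithms

There are three copies of the variables, `X` (copy `0`), `X'` (copy `1`) and `X''` (copy `2`).  As
(reduced, ordered) BDDs represent assertions canonically and symbolic time only counts operations,
a BDD is identified with the assertion that it represents. -/

/-- Valuations of the three copies of the variables. -/
abbrev Val (m n : ℕ) := Fin 3 → State m n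

/-- BDDs over the three copies of the variables. -/
abbrev BDD (m n : ℕ) := Set (Val m n)

/-- The symbolic operations; their BDD arguments are given by register numbers.  The quantifiers
bind all the input variables, or all the output variables, of the copy `c`. -/
inductive Op where
  | neg (a : ℕ)
  | conj (a b : ℕ)
  | disj (a b : ℕ)
  | impl (a b : ℕ)
  | exIn (c : Fin 3) (a : ℕ)
  | exOut (c : Fin 3) (a : ℕ)
  | allIn (c : Fin 3) (a : ℕ)
  | allOut (c : Fin 3) (a : ℕ)
  /-- the inputs of copy `c` equal those of copy `d` -/
  | eqIn (c d : Fin 3)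
  /-- the outputs of copy `c` equal those of copy `d` -/
  | eqOut (c d : Fin 3)
  /-- a single input variable of copy `c`, whose index is held by counter `k` -/
  | varIn (c : Fin 3) (k : ℕ)
  /-- a single output variable of copy `c`, whose index is held by counter `k` -/
  | varOut (c : Fin 3) (k : ℕ)

/-- Tests: equality of the BDDs in two registers, and whether a counter is the index of an input
variable, or of an output variable. -/
inductive Test where
  | same (a b : ℕ)
  | isIn (k : ℕ)
  | isOut (k : ℕ)
  | neg (b : Test)

/-- Symbolic programs.  The text of a program does not depend on the game, nor on the numbers of
variables. -/
inductive Prog where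
  | skip
  | op (r : ℕ) (e : Op)
  | zero (k : ℕ)
  | inc (k : ℕ)
  | seq (P Q : Prog)
  | ite (b : Test) (P Q : Prog)
  | loop (b : Test) (P : Prog)

/-- The memory: BDD registers and counters. -/
structure Store (m n : ℕ) where
  bdd : ℕ → BDD m n
  ctr : ℕ → ℕ

/-- The BDD computed by a symbolic operation. -/
def Op.eval {m n : ℕ} (σ : Store m n) : Op → BDD m n
  | .neg a => {v | v ∉ σ.bdd a}
  | .conj a b => {v | v ∈ σ.bdd a ∧ v ∈ σ.bdd b}
  | .disj a b => {v | v ∈ σ.bdd a ∨ v ∈ σ.bdd b}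
  | .impl a b => {v | v ∈ σ.bdd a → v ∈ σ.bdd b}
  | .exIn c a => {v | ∃ i : Input m, Function.update v c (i, (v c).2) ∈ σ.bdd a}
  | .exOut c a => {v | ∃ o : Output n, Function.update v c ((v c).1, o) ∈ σ.bdd a}
  | .allIn c a => {v | ∀ i : Input m, Function.update v c (i, (v c).2) ∈ σ.bdd a}
  | .allOut c a => {v | ∀ o : Output n, Function.update v c ((v c).1, o) ∈ σ.bdd a}
  | .eqIn c d => {v | (v c).1 = (v d).1}
  | .eqOut c d => {v | (v c).2 = (v d).2}
  | .varIn c k => {v | ∃ h : σ.ctr k < m, (v c).1 ⟨σ.ctr k, h⟩ = true}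
  | .varOut c k => {v | ∃ h : σ.ctr k < n, (v c).2 ⟨σ.ctr k, h⟩ = true}

/-- The outcome of a test. -/
def Test.Holds {m n : ℕ} (σ : Store m n) : Test → Prop
  | .same a b => σ.bdd a = σ.bdd b
  | .isIn k => σ.ctr k < m
  | .isOut k => σ.ctr k < n
  | .neg b => ¬ b.Holds σ

/-- `Exec P σ t τ`: started on `σ`, the program `P` halts with memory `τ` after `t` steps.  A step
is a symbolic operation, a test or a counter operation; so `t` bounds the number of symbolic
operations, also when tests of equality of BDDs are counted among them. -/
inductive Exec {m n : ℕ} : Prog → Store m n → ℕ → Store m n → Prop where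
  | skip (σ : Store m n) : Exec .skip σ 0 σ
  | op (σ : Store m n) (r : ℕ) (e : Op) :
      Exec (.op r e) σ 1 ⟨Function.update σ.bdd r (e.eval σ), σ.ctr⟩
  | zero (σ : Store m n) (k : ℕ) :
      Exec (.zero k) σ 1 ⟨σ.bdd, Function.update σ.ctr k 0⟩
  | inc (σ : Store m n) (k : ℕ) :
      Exec (.inc k) σ 1 ⟨σ.bdd, Function.update σ.ctr k (σ.ctr k + 1)⟩
  | seq {P Q : Prog} {σ ρ τ : Store m n} {t u : ℕ} :
      Exec P σ t ρ → Exec Q ρ u τ → Exec (.seq P Q) σ (t + u) τ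
  | iteTrue {b : Test} {P Q : Prog} {σ τ : Store m n} {t : ℕ} :
      b.Holds σ → Exec P σ t τ → Exec (.ite b P Q) σ (t + 1) τ
  | iteFalse {b : Test} {P Q : Prog} {σ τ : Store m n} {t : ℕ} :
      ¬ b.Holds σ → Exec Q σ t τ → Exec (.ite b P Q) σ (t + 1) τ
  | loopTrue {b : Test} {P : Prog} {σ ρ τ : Store m n} {t u : ℕ} :
      b.Holds σ → Exec P σ t ρ → Exec (.loop b P) ρ u τ → Exec (.loop b P) σ (t + u + 1) τ
  | loopFalse {b : Test} {P : Prog} {σ : Store m n} :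
      ¬ b.Holds σ → Exec (.loop b P) σ 1 σ

/-- The initial memory: registers `0, …, 4` hold the BDDs of the game structure and of `acc`, all
other registers hold the BDD `false`, and all counters are `0`. -/
def GameStructure.initialStore {m n : ℕ} (G : GameStructure m n) (acc : Set (State m n)) :
    Store m n where
  bdd
    | 0 => {v | (v 0).1 ∈ G.initIn}
    | 1 => {v | v 0 ∈ G.initOut}
    | 2 => {v | G.safeIn (v 0) (v 1).1}
    | 3 => {v | G.safeOut (v 0) (v 1)}
    | 4 => {v | v 0 ∈ acc}
    | _ => ∅
  ctr _ := 0

/-- The BDD `W(X)` represents the set of states `A`. -/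
def RepresentsSet {m n : ℕ} (W : BDD m n) (A : Set (State m n)) : Prop :=
  ∀ v : Val m n, v ∈ W ↔ v 0 ∈ A

/-- The BDD `F(X, X')` represents `f`: `(s, (i', o'))` satisfies it iff `f s i = o`. -/
def RepresentsStrategy {m n : ℕ} (F : BDD m n) (f : State m n → Input m → Output n) : Prop :=
  ∀ v : Val m n, v ∈ F ↔ f (v 0) (v 1).1 = (v 1).2

/-- The BDD `D(X)` represents the choice `g` of initial outputs. -/
def RepresentsInitial {m n : ℕ} (D : BDD m n) (g : Input m → Output n) : Prop :=
  ∀ v : Val m n, v ∈ D ↔ g (v 0).1 = (v 0).2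

end WeakBuchi

namespace WeakBuchi

/-! ### Certificates for the winning regions of the two players -/

/-! The states are decided round by round. `W` collects states won by the system, `L` states won by
the environment, and the certificate `Decided` equips both with a rank that never increases along
the winner's moves and drops strictly at states bad for the winner. A rank in `ℕ` drops only
finitely often, so plays kept in `W` end up in `acc` for good and those kept in `L` end up outside
it (`Decided.winsFrom`, `Decided.not_winsFrom`).

A round first adds the undecided states from which one player forces the play into that player's own
region in one step. If there are none, neither player can be driven from an undecided state into the
opponent's region. An undecided state whose reachable undecided states are all accepting is then won
by the system, and dually for the environment. Weakness guarantees such a state: take an undecided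
state that is minimal for reachability (`GameStructure.IsWeak.exists_trapped`). Hence every round
decides a state, and `N` rounds suffice.

A round costs a constant number of operations because the reachability relation is computed once
beforehand. That takes at most `N` extensions by one edge, carried out for all sources
simultaneously. Finally, functions are extracted from the relation of winning moves by fixing one
output variable at a time, which takes `n < N` rounds. A small Hoare logic with step counts (`Runs`)
transfers all this to programs. -/

/-- The sets `W` and `L` have been decided for the system and the environment.  The moves in `T`
keep the system in `W` and those of the environment keep it in `L`; both let the rank decrease,
except possibly in states that are good for the player. -/
structure Decided {m n : ℕ} (G : GameStructure m n) (acc W L : Set (State m n))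
    (T : State m n → State m n → Prop) (rank : State m n → ℕ) : Prop where
  disj : ∀ s ∈ W, s ∉ L
  move : ∀ s ∈ W, ∀ i, G.safeIn s i → ∃ o, T s (i, o)
  sound : ∀ s t, T s t → s ∈ W ∧ G.safeOut s t ∧ t ∈ W ∧ rank t ≤ rank s ∧
    (s ∉ acc → rank t < rank s)
  spoil : ∀ s ∈ L, ∃ i, G.safeIn s i ∧ ∀ o, G.safeOut s (i, o) →
    (i, o) ∈ L ∧ rank (i, o) ≤ rank s ∧ (s ∈ acc → rank (i, o) < rank s)

theorem exists_eventually_const (a : ℕ → ℕ) (h : ∀ k, a (k + 1) ≤ a k) :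
    ∃ k₀, ∀ k, k₀ ≤ k → a (k + 1) = a k := by
  have ha : Antitone a := antitone_nat_of_succ_le h
  obtain ⟨k₀, hk₀⟩ := WellFounded.has_min (wellFounded_lt (α := ℕ)) (Set.range a) ⟨a 0, 0, rfl⟩
  obtain ⟨⟨k₀, rfl⟩, hmin⟩ := hk₀
  refine ⟨k₀, fun k hk => ?_⟩
  have h1 := hmin (a (k + 1)) ⟨_, rfl⟩
  have h2 := ha hk
  have h3 := h k
  omega

theorem history_succ {m n : ℕ} (p : ℕ → State m n) (k : ℕ) :
    history p (k + 1) = history p k ++ [p (k + 1)] := by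
  simp [history, List.range_succ]

theorem memoryless_history {m n : ℕ} (g : Input m → Output n) (f : State m n → Input m → Output n)
    (p : ℕ → State m n) (k : ℕ) (i : Input m) :
    memoryless g f (history p k) i = f (p k) i := by
  simp [memoryless, history, List.range_succ]

variable {m n : ℕ} {G : GameStructure m n} {acc W L : Set (State m n)}
  {T : State m n → State m n → Prop} {rank : State m n → ℕ}

/-- Once the rank is constant, every further state is accepting, since leaving a non-accepting one
would lower it. Any function that follows `T` where `T` offers a move will do, so the program is
free in its choice of outputs. -/
theorem Decided.winsFrom (h : Decided G acc W L T rank) {f : State m n → Input m → Output n}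
    (hf : ∀ s i, (∃ o, T s (i, o)) → T s (i, f s i)) (g : Input m → Output n)
    {s : State m n} (hs : s ∈ W) : G.WinsFrom acc (memoryless g f) s := by
  have step : ∀ (p : ℕ → State m n) (k : ℕ), p k ∈ W → G.ConsistentAt (memoryless g f) p k →
      T (p k) (p (k + 1)) := by
    intro p k hk hc
    obtain ⟨h1, h2⟩ := hc
    rw [memoryless_history] at h2
    have := hf _ _ (h.move _ hk _ h1)
    rwa [← h2] at this
  have inW : ∀ (p : ℕ → State m n) (k : ℕ), p 0 = s →
      (∀ j < k, G.ConsistentAt (memoryless g f) p j) → p k ∈ W := by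
    intro p k h0
    induction k with
    | zero => intro _; rwa [h0]
    | succ k ih =>
      intro hc
      exact (h.sound _ _ (step p k (ih fun j hj => hc j (by omega)) (hc k (by omega)))).2.2.1
  refine ⟨fun p k h0 hc i hi => ?_, fun p h0 hc k => ?_⟩
  · rw [memoryless_history]
    exact (h.sound _ _ (hf _ _ (h.move _ (inW p k h0 hc) i hi))).2.1
  · have hT : ∀ k, T (p k) (p (k + 1)) := fun k => step p k (inW p k h0 fun j _ => hc j) (hc k)
    obtain ⟨k₀, hk₀⟩ := exists_eventually_const (fun k => rank (p k))
      fun k => (h.sound _ _ (hT k)).2.2.2.1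
    refine ⟨max k k₀, le_max_left _ _, ?_⟩
    by_contra hacc
    have h1 := (h.sound _ _ (hT (max k k₀))).2.2.2.2 hacc
    have h2 := hk₀ (max k k₀) (le_max_right _ _)
    omega

/-- The histories of the play in which the environment plays `e` and the system plays `f`. -/
def playHistory (e : State m n → Input m) (f : Strategy m n) (s : State m n) :
    ℕ → List (State m n)
  | 0 => [s]
  | k + 1 => playHistory e f s k ++
      [(e ((playHistory e f s k).getLastD s),
        f (playHistory e f s k) (e ((playHistory e f s k).getLastD s)))]

/-- The answer of `f` depends on the whole past, so the recursion builds histories and the play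
reads off their last entries. These lists are nonempty, so the default `s` is never used. -/
theorem exists_play (e : State m n → Input m) (f : Strategy m n) (s : State m n) :
    ∃ p : ℕ → State m n, p 0 = s ∧
      ∀ k, p (k + 1) = (e (p k), f (history p k) (e (p k))) := by
  refine ⟨fun k => (playHistory e f s k).getLastD s, rfl, ?_⟩
  have H : ∀ k, history (fun k => (playHistory e f s k).getLastD s) k = playHistory e f s k := by
    intro k
    induction k with
    | zero => simp [history, playHistory]
    | succ k ih =>
      rw [history_succ, ih]
      simp [playHistory]
  intro k
  rw [H]
  simp [playHistory]

/-- The environment plays the spoiling inputs positionally against an arbitrary `f`. If all answers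
are legal, the play stays in `L`, and a visit to `acc` after the rank has settled would lower it
again. -/
theorem Decided.not_winsFrom (h : Decided G acc W L T rank) {s : State m n} (hs : s ∈ L)
    (f : Strategy m n) : ¬ G.WinsFrom acc f s := by
  intro hf
  have h' : ∀ s, ∃ i, s ∈ L → G.safeIn s i ∧ ∀ o, G.safeOut s (i, o) →
      (i, o) ∈ L ∧ rank (i, o) ≤ rank s ∧ (s ∈ acc → rank (i, o) < rank s) := by
    intro s
    by_cases hs : s ∈ L
    · obtain ⟨i, hi⟩ := h.spoil s hs
      exact ⟨i, fun _ => hi⟩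
    · exact ⟨fun _ => false, fun h => absurd h hs⟩
  choose e he using h'
  obtain ⟨p, h0, hp⟩ := exists_play e f s
  have cons : ∀ k, p k ∈ L → G.ConsistentAt f p k := by
    intro k hk
    have := (he _ hk).1
    refine ⟨?_, ?_⟩ <;> simp [hp k, this]
  -- Legality of the answer at time `k` needs consistency of the whole prefix, hence membership in
  -- `L` at all earlier times.
  have inL : ∀ k, ∀ j ≤ k, p j ∈ L := by
    intro k
    induction k with
    | zero => intro j hj; obtain rfl : j = 0 := by omega
              rwa [h0]
    | succ k ih =>
      intro j hj
      rcases Nat.lt_or_ge j (k + 1) with hj' | hj'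
      · exact ih j (by omega)
      · obtain rfl : j = k + 1 := by omega
        have hk := ih k le_rfl
        have := hf.1 p k h0 (fun j hj => cons j (ih j hj.le)) (e (p k)) (he _ hk).1
        rw [hp k]
        exact ((he _ hk).2 _ this).1
  have key : ∀ k, rank (p (k + 1)) ≤ rank (p k) ∧ (p k ∈ acc → rank (p (k + 1)) < rank (p k)) := by
    intro k
    have hk := inL k k le_rfl
    have := hf.1 p k h0 (fun j hj => cons j (inL k j hj.le)) (e (p k)) (he _ hk).1
    rw [hp k]
    exact ((he _ hk).2 _ this).2
  obtain ⟨k₀, hk₀⟩ := exists_eventually_const (fun k => rank (p k)) fun k => (key k).1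
  obtain ⟨j, hj, hacc⟩ := hf.2 p h0 (fun j => cons j (inL j j le_rfl)) k₀
  have h1 := (key j).2 hacc
  have h2 := hk₀ j hj
  omega

theorem Decided.winningRegion_eq (h : Decided G acc W L T rank) (hU : ∀ s, s ∈ W ∨ s ∈ L) :
    G.winningRegion acc = W := by
  classical
  ext s
  constructor
  · rintro ⟨f, hf⟩
    exact (hU s).resolve_right fun hs => h.not_winsFrom hs f hf
  · intro hs
    have : ∀ s i, ∃ o', (∃ o, T s (i, o)) → T s (i, o') := fun s i => by
      by_cases hT : ∃ o, T s (i, o)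
      · exact ⟨hT.choose, fun _ => hT.choose_spec⟩
      · exact ⟨fun _ => false, fun h => absurd h hT⟩
    choose f hf using this
    exact ⟨_, h.winsFrom hf (fun _ _ => false) hs⟩

/-! ### Deciding further states -/

/-- The system can force the play into `W` in one step. -/
def GameStructure.cpre (G : GameStructure m n) (W : Set (State m n)) : Set (State m n) :=
  {s | ∀ i, G.safeIn s i → ∃ o, G.safeOut s (i, o) ∧ (i, o) ∈ W}

/-- The environment can force the play into `L` in one step, or win at once. -/
def GameStructure.epre (G : GameStructure m n) (L : Set (State m n)) : Set (State m n) :=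
  {s | ∃ i, G.safeIn s i ∧ ∀ o, G.safeOut s (i, o) → (i, o) ∈ L}

/-- Adding sets `A` and `B` of undecided states to `W` and `L`, all with the same new rank. -/
theorem Decided.extend (h : Decided G acc W L T rank) {b : ℕ}
    (hb : ∀ s, s ∈ W ∨ s ∈ L → rank s < b) {A B : Set (State m n)} {V : Set (State m n)}
    (hA : ∀ s ∈ A, s ∉ W ∧ s ∉ L) (hB : ∀ s ∈ B, s ∉ W ∧ s ∉ L) (hAB : ∀ s ∈ A, s ∉ B)
    (hWV : ∀ s ∈ V, s ∈ W ∨ s ∈ A) (hAV : A ⊆ G.cpre V) (hacc : ∀ s ∈ A, s ∉ acc → V ⊆ W)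
    (hB' : ∀ s ∈ B, ∃ i, G.safeIn s i ∧ ∀ o, G.safeOut s (i, o) →
      (i, o) ∈ L ∨ (s ∉ acc ∧ (i, o) ∈ B)) :
    ∃ rank', Decided G acc (W ∪ A) (L ∪ B)
        (fun s t => T s t ∨ (s ∈ A ∧ G.safeOut s t ∧ t ∈ V)) rank' ∧
      ∀ s, s ∈ W ∪ A ∨ s ∈ L ∪ B → rank' s < b + 1 := by
  classical
  -- The value `b` exceeds all old ranks: moves from new to old states are strict decreases, and
  -- moves among new states keep the rank.
  let rank' : State m n → ℕ := fun s => if s ∈ W ∨ s ∈ L then rank s else b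
  have old : ∀ s, s ∈ W ∨ s ∈ L → rank' s = rank s := fun s hs => if_pos hs
  have new : ∀ s, s ∉ W ∧ s ∉ L → rank' s = b := fun s hs => if_neg (by tauto)
  have le : ∀ s, rank' s ≤ b := fun s => by
    by_cases hs : s ∈ W ∨ s ∈ L
    · rw [old s hs]; exact (hb s hs).le
    · rw [new s (by tauto)]
  refine ⟨rank', ⟨?_, ?_, ?_, ?_⟩, fun s _ => Nat.lt_succ_of_le (le s)⟩
  · rintro s (hs | hs) (hs' | hs')
    · exact h.disj s hs hs'
    · exact (hB s hs').1 hs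
    · exact (hA s hs).2 hs'
    · exact hAB s hs hs'
  · rintro s (hs | hs) i hi
    · obtain ⟨o, ho⟩ := h.move s hs i hi
      exact ⟨o, Or.inl ho⟩
    · obtain ⟨o, ho⟩ := hAV hs i hi
      exact ⟨o, Or.inr ⟨hs, ho⟩⟩
  · rintro s t (hT | ⟨hs, hst, ht⟩)
    · obtain ⟨h1, h2, h3, h4, h5⟩ := h.sound s t hT
      rw [old s (Or.inl h1), old t (Or.inl h3)]
      exact ⟨Or.inl h1, h2, Or.inl h3, h4, h5⟩
    · rw [new s (hA s hs)]
      refine ⟨Or.inr hs, hst, hWV t ht, le t, fun hsa => ?_⟩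
      have htW := hacc s hs hsa ht
      rw [old t (Or.inl htW)]
      exact hb t (Or.inl htW)
  · rintro s (hs | hs)
    · obtain ⟨i, hi, ho⟩ := h.spoil s hs
      refine ⟨i, hi, fun o hso => ?_⟩
      obtain ⟨h1, h2⟩ := ho o hso
      rw [old s (Or.inr hs), old _ (Or.inr h1)]
      exact ⟨Or.inl h1, h2⟩
    · obtain ⟨i, hi, ho⟩ := hB' s hs
      refine ⟨i, hi, fun o hso => ?_⟩
      rw [new s (hB s hs)]
      rcases ho o hso with h1 | ⟨h1, h2⟩
      · have := hb _ (Or.inr h1)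
        rw [old _ (Or.inr h1)]
        exact ⟨Or.inl h1, this.le, fun _ => this⟩
      · exact ⟨Or.inr h2, le _, fun h => absurd h h1⟩

/-- `W`, `L` and `T` are decided with some bounded rank. -/
def DecidedBy (G : GameStructure m n) (acc W L : Set (State m n))
    (T : State m n → State m n → Prop) : Prop :=
  ∃ rank b, Decided G acc W L T rank ∧ ∀ s, s ∈ W ∨ s ∈ L → rank s < b

theorem decidedBy_empty (G : GameStructure m n) (acc : Set (State m n)) :
    DecidedBy G acc ∅ ∅ (fun _ _ => False) :=
  ⟨fun _ => 0, 0, ⟨by simp, by simp, by simp, by simp⟩, by simp⟩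

/-- New states move straight into states of smaller rank, so acceptance plays no role. A state in
both `A` and `B` would let the play be forced into a common element of `W` and `L`. -/
theorem DecidedBy.attract (h : DecidedBy G acc W L T) {A B : Set (State m n)}
    (hA : A = {s | (s ∉ W ∧ s ∉ L) ∧ s ∈ G.cpre W})
    (hB : B = {s | (s ∉ W ∧ s ∉ L) ∧ s ∈ G.epre L}) :
    DecidedBy G acc (W ∪ A) (L ∪ B) (fun s t => T s t ∨ (s ∈ A ∧ G.safeOut s t ∧ t ∈ W)) := by
  obtain ⟨rank, b, h, hb⟩ := h
  subst hA hB
  refine Exists.imp (fun rank' h' => ⟨b + 1, h'⟩) (h.extend hb (V := W) (fun s hs => hs.1)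
    (fun s hs => hs.1) ?_ (fun s hs => Or.inl hs) (fun s hs => hs.2) (fun _ _ _ => subset_rfl) ?_)
  · rintro s ⟨-, hs⟩ ⟨-, i, hi, ho⟩
    obtain ⟨o, h1, h2⟩ := hs i hi
    exact h.disj _ h2 (ho o h1)
  · rintro s ⟨-, i, hi, ho⟩
    exact ⟨i, hi, fun o h => Or.inl (ho o h)⟩

/-- The undecided states of `Q` from which all reachable undecided states lie in `Q`. -/
def trapped (G : GameStructure m n) (W L Q : Set (State m n)) : Set (State m n) :=
  {s | (s ∉ W ∧ s ∉ L) ∧ s ∈ Q ∧ ∀ t, Relation.ReflTransGen G.Edge s t → t ∉ W ∧ t ∉ L → t ∈ Q}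

theorem trapped_of_edge {Q : Set (State m n)} {s t : State m n} (hs : s ∈ trapped G W L Q)
    (h : G.Edge s t) (ht : t ∉ W ∧ t ∉ L) : t ∈ trapped G W L Q :=
  ⟨ht, hs.2.2 t (.single h) ht, fun u hu => hs.2.2 u (.head h hu)⟩

/-- Outside `G.epre L`, the system can answer every input without entering `L`; the successor is in
`W` or is again trapped in `acc`, where the rank need not drop. Dually, outside `G.cpre W` the
environment has an input after which `W` is unreachable in one step. -/
theorem DecidedBy.trap (h : DecidedBy G acc W L T)
    (hA : ∀ s, s ∉ W → s ∉ L → s ∉ G.cpre W)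
    (hB : ∀ s, s ∉ W → s ∉ L → s ∉ G.epre L) :
    DecidedBy G acc (W ∪ trapped G W L acc) (L ∪ trapped G W L accᶜ)
      (fun s t => T s t ∨ (s ∈ trapped G W L acc ∧ G.safeOut s t ∧
        t ∈ W ∪ trapped G W L acc)) := by
  obtain ⟨rank, b, h, hb⟩ := h
  refine Exists.imp (fun rank' h' => ⟨b + 1, h'⟩) (h.extend hb (A := trapped G W L acc)
    (B := trapped G W L accᶜ) (V := W ∪ trapped G W L acc) (fun s hs => hs.1) (fun s hs => hs.1)
    (fun s hs hs' => hs'.2.1 hs.2.1) (fun s hs => hs) ?_ (fun s hs hs' => absurd hs.2.1 hs') ?_)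
  · intro s hs i hi
    have := hB s hs.1.1 hs.1.2
    simp only [GameStructure.epre, Set.mem_ofPred_eq, not_exists, not_and, not_forall] at this
    obtain ⟨o, ho, hL⟩ := this i hi
    refine ⟨o, ho, ?_⟩
    by_cases hW : (i, o) ∈ W
    · exact Or.inl hW
    · exact Or.inr (trapped_of_edge hs ⟨hi, ho⟩ ⟨hW, hL⟩)
  · intro s hs
    have := hA s hs.1.1 hs.1.2
    simp only [GameStructure.cpre, Set.mem_ofPred_eq, not_exists, not_and, not_forall] at this
    obtain ⟨i, hi, ho⟩ := this
    refine ⟨i, hi, fun o hso => ?_⟩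
    by_cases hL : (i, o) ∈ L
    · exact Or.inl hL
    · exact Or.inr ⟨hs.2.1, trapped_of_edge hs ⟨hi, hso⟩ ⟨ho o hso, hL⟩⟩

/-- Every undecided state reachable from a minimal one reaches it back, so both share a strongly
connected component, on which acceptance is constant. -/
theorem GameStructure.IsWeak.exists_trapped (hw : G.IsWeak acc) {u : State m n}
    (hu : u ∉ W ∧ u ∉ L) : ∃ s, s ∈ trapped G W L acc ∨ s ∈ trapped G W L accᶜ := by
  let lt : State m n → State m n → Prop := fun s t =>
    Relation.ReflTransGen G.Edge t s ∧ ¬ Relation.ReflTransGen G.Edge s t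
  have : IsTrans (State m n) lt := ⟨fun a b c hab hbc =>
    ⟨hbc.1.trans hab.1, fun h => hbc.2 (hab.1.trans h)⟩⟩
  have : Std.Irrefl lt := ⟨fun a h => h.2 h.1⟩
  obtain ⟨s, hs, hmin⟩ := (Finite.wellFounded_of_trans_of_irrefl lt).has_min
    {s | s ∉ W ∧ s ∉ L} ⟨u, hu⟩
  have back : ∀ t, Relation.ReflTransGen G.Edge s t → t ∉ W ∧ t ∉ L → (s ∈ acc ↔ t ∈ acc) := by
    intro t hst ht
    refine hw s t ⟨hst, ?_⟩
    by_contra hts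
    exact hmin t ht ⟨hst, hts⟩
  refine ⟨s, ?_⟩
  by_cases hacc : s ∈ acc
  · exact Or.inl ⟨hs, hacc, fun t h1 h2 => (back t h1 h2).1 hacc⟩
  · exact Or.inr ⟨hs, hacc, fun t h1 h2 h3 => hacc ((back t h1 h2).2 h3)⟩

end WeakBuchi
namespace WeakBuchi

/-! ### A program logic

Registers below `16` hold program variables, those from `16` on are used for intermediate results.
The counter `0` is the only one used. -/

/-- The program variables in the memory. -/
def Store.view {m n : ℕ} (σ : Store m n) : Fin 16 → BDD m n := fun r => σ.bdd r

/-- Started on variables `β` and counter `k`, the program halts after at most `c` steps with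
variables and counter satisfying `Q`. -/
def Runs {m n : ℕ} (P : Prog) (c : ℕ) (β : Fin 16 → BDD m n) (k : ℕ)
    (Q : (Fin 16 → BDD m n) → ℕ → Prop) : Prop :=
  ∀ σ : Store m n, σ.view = β → σ.ctr 0 = k → ∃ t τ, Exec P σ t τ ∧ t ≤ c ∧ Q τ.view (τ.ctr 0)

/-- A test, in terms of the program variables. -/
inductive Cond where
  | ne (a b : Fin 16)
  | isOut

/-- The corresponding test of symbolic programs. -/
def Cond.test : Cond → Test
  | .ne a b => .neg (.same a b)
  | .isOut => .isOut 0

/-- The truth value of a test. -/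
def Cond.Holds {m n : ℕ} (β : Fin 16 → BDD m n) (k : ℕ) : Cond → Prop
  | .ne a b => β a ≠ β b
  | .isOut => k < n

theorem Cond.test_holds {m n : ℕ} (b : Cond) (σ : Store m n) :
    b.test.Holds σ ↔ b.Holds σ.view (σ.ctr 0) := by
  cases b <;> rfl

section

variable {m n : ℕ} {P P₁ P₂ : Prog} {c c₁ c₂ : ℕ} {β : Fin 16 → BDD m n} {k : ℕ}
  {Q Q' : (Fin 16 → BDD m n) → ℕ → Prop}

theorem Runs.mono (h : Runs P c₁ β k Q) (hc : c₁ ≤ c₂) (hQ : ∀ β k, Q β k → Q' β k) :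
    Runs P c₂ β k Q' := fun σ h1 h2 => by
  obtain ⟨t, τ, h3, h4, h5⟩ := h σ h1 h2
  exact ⟨t, τ, h3, h4.trans hc, hQ _ _ h5⟩

/-- The postcondition of `P₁` is itself a `Runs` statement, so programs are verified from left to
right without naming intermediate assertions. -/
theorem Runs.seq (h : Runs P₁ c₁ β k fun β' k' => Runs P₂ c₂ β' k' Q) :
    Runs (.seq P₁ P₂) (c₁ + c₂) β k Q := fun σ h1 h2 => by
  obtain ⟨t, ρ, h3, h4, h5⟩ := h σ h1 h2
  obtain ⟨u, τ, h6, h7, h8⟩ := h5 ρ rfl rfl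
  exact ⟨t + u, τ, .seq h3 h6, Nat.add_le_add h4 h7, h8⟩

theorem Runs.ite {b : Cond} (h₁ : b.Holds β k → Runs P₁ c β k Q)
    (h₂ : ¬ b.Holds β k → Runs P₂ c β k Q) : Runs (.ite b.test P₁ P₂) (c + 1) β k Q := by
  rintro σ rfl rfl
  by_cases hb : b.Holds σ.view (σ.ctr 0)
  · obtain ⟨t, τ, h3, h4, h5⟩ := h₁ hb σ rfl rfl
    exact ⟨t + 1, τ, .iteTrue ((b.test_holds σ).2 hb) h3, Nat.succ_le_succ h4, h5⟩
  · obtain ⟨t, τ, h3, h4, h5⟩ := h₂ hb σ rfl rfl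
    exact ⟨t + 1, τ, .iteFalse (fun h => hb ((b.test_holds σ).1 h)) h3, Nat.succ_le_succ h4, h5⟩

/-- A loop whose invariant `I j` bounds the number of the remaining rounds by `j`. -/
theorem Runs.loop {b : Cond} (I : ℕ → (Fin 16 → BDD m n) → ℕ → Prop)
    (hstep : ∀ j β k, I j β k → b.Holds β k →
      Runs P c β k fun β' k' => ∃ j' < j, I j' β' k') {j : ℕ} (h : I j β k) :
    Runs (.loop b.test P) (j * (c + 1) + 1) β k
      fun β' k' => ¬ b.Holds β' k' ∧ ∃ j', I j' β' k' := by
  induction j using Nat.strong_induction_on generalizing β k with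
  | _ j ih =>
    rintro σ rfl rfl
    by_cases hb : b.Holds σ.view (σ.ctr 0)
    · obtain ⟨t, ρ, h3, h4, j', hj, h5⟩ := hstep j _ _ h hb σ rfl rfl
      obtain ⟨u, τ, h6, h7, h8⟩ := ih j' hj h5 ρ rfl rfl
      refine ⟨t + u + 1, τ, .loopTrue ((b.test_holds σ).2 hb) h3 h6, ?_, h8⟩
      -- From `j' + 1 ≤ j`, one summand `c + 1` is left for this round's body and test; the final `+
      -- 1` pays for the failing test.
      have := Nat.mul_le_mul_right (c + 1) (Nat.succ_le_of_lt hj)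
      rw [Nat.succ_mul] at this
      omega
    · exact ⟨1, σ, .loopFalse fun h => hb ((b.test_holds σ).1 h), by omega, hb, j, h⟩

theorem Runs.zero (h : Q β 0) : Runs (.zero 0) 1 β k Q := fun σ h1 h2 =>
  ⟨1, _, .zero σ 0, le_rfl, by subst h1; simp only [Function.update_self]; exact h⟩

theorem Runs.inc (h : Q β (k + 1)) : Runs (.inc 0) 1 β k Q := fun σ h1 h2 =>
  ⟨1, _, .inc σ 0, le_rfl, by subst h1 h2; simp only [Function.update_self]; exact h⟩

end

/-! ### Expressions -/

/-- Compound symbolic operations. -/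
inductive Expr where
  | reg (a : Fin 16)
  | neg (e : Expr)
  | conj (e f : Expr)
  | disj (e f : Expr)
  | exIn (c : Fin 3) (e : Expr)
  | exOut (c : Fin 3) (e : Expr)
  | allIn (c : Fin 3) (e : Expr)
  | eqIn (c d : Fin 3)
  | eqOut (c d : Fin 3)
  | varOut (c : Fin 3)

namespace Expr

/-- The BDD denoted by an expression. -/
def eval {m n : ℕ} (β : Fin 16 → BDD m n) (k : ℕ) : Expr → BDD m n
  | reg a => β a
  | neg e => {v | v ∉ e.eval β k}
  | conj e f => {v | v ∈ e.eval β k ∧ v ∈ f.eval β k}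
  | disj e f => {v | v ∈ e.eval β k ∨ v ∈ f.eval β k}
  | exIn c e => {v | ∃ i : Input m, Function.update v c (i, (v c).2) ∈ e.eval β k}
  | exOut c e => {v | ∃ o : Output n, Function.update v c ((v c).1, o) ∈ e.eval β k}
  | allIn c e => {v | ∀ i : Input m, Function.update v c (i, (v c).2) ∈ e.eval β k}
  | eqIn c d => {v | (v c).1 = (v d).1}
  | eqOut c d => {v | (v c).2 = (v d).2}
  | varOut c => {v | ∃ h : k < n, (v c).2 ⟨k, h⟩ = true}

/-- The number of operations in an expression. -/
def cost : Expr → ℕ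
  | neg e | exIn _ e | exOut _ e | allIn _ e => e.cost + 1
  | conj e f | disj e f => e.cost + (f.cost + 1)
  | _ => 1

/-- Evaluation into the register `r`, with intermediate results in the registers from `r` on. -/
def compile : Expr → ℕ → Prog
  -- No operation copies a register, so a disjunction with itself is used.
  | reg a, r => .op r (.disj a a)
  | neg e, r => .seq (e.compile r) (.op r (.neg r))
  | conj e f, r => .seq (e.compile r) (.seq (f.compile (r + 1)) (.op r (.conj r (r + 1))))
  | disj e f, r => .seq (e.compile r) (.seq (f.compile (r + 1)) (.op r (.disj r (r + 1))))
  | exIn c e, r => .seq (e.compile r) (.op r (.exIn c r))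
  | exOut c e, r => .seq (e.compile r) (.op r (.exOut c r))
  | allIn c e, r => .seq (e.compile r) (.op r (.allIn c r))
  | eqIn c d, r => .op r (.eqIn c d)
  | eqOut c d, r => .op r (.eqOut c d)
  | varOut c, r => .op r (.varOut c 0)

theorem view_eq {m n r : ℕ} {σ τ : Store m n} (hr : 16 ≤ r) (h : ∀ j < r, τ.bdd j = σ.bdd j) :
    τ.view = σ.view :=
  funext fun j => h j (by omega)

theorem exec_op {m n : ℕ} {P : Prog} {r t : ℕ} {o : Op} {σ τ : Store m n} {b : BDD m n}
    (h : Exec P σ t τ) (hc : τ.ctr = σ.ctr) (hj : ∀ j < r, τ.bdd j = σ.bdd j)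
    (ho : o.eval τ = b) :
    ∃ τ, Exec (.seq P (.op r o)) σ (t + 1) τ ∧ τ.ctr = σ.ctr ∧ τ.bdd r = b ∧
      ∀ j < r, τ.bdd j = σ.bdd j :=
  ⟨_, .seq h (.op τ r o), hc, by simp [ho], fun j hj' => by
    simp [Function.update_of_ne hj'.ne, hj j hj']⟩

theorem exec_atom {m n : ℕ} (r : ℕ) (σ : Store m n) {o : Op} {b : BDD m n} (ho : o.eval σ = b) :
    ∃ τ, Exec (.op r o) σ 1 τ ∧ τ.ctr = σ.ctr ∧ τ.bdd r = b ∧ ∀ j < r, τ.bdd j = σ.bdd j :=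
  ⟨_, .op σ r o, rfl, by simp [ho], fun j hj' => by simp [Function.update_of_ne hj'.ne]⟩

/-- Right operands are evaluated from `r + 1` on and so preserve the left value in `r`. Preservation
of all registers below `r` carries the induction and, as `16 ≤ r`, protects the program variables.
-/
theorem exec_compile {m n : ℕ} (e : Expr) (r : ℕ) (hr : 16 ≤ r) (σ : Store m n) :
    ∃ τ, Exec (e.compile r) σ e.cost τ ∧ τ.ctr = σ.ctr ∧
      τ.bdd r = e.eval σ.view (σ.ctr 0) ∧ ∀ j < r, τ.bdd j = σ.bdd j := by
  induction e generalizing r σ with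
  | reg a => exact exec_atom r σ (by simp [Op.eval, eval, Store.view])
  | eqIn c d | eqOut c d | varOut c => exact exec_atom r σ rfl
  | neg e ih | exIn c e ih | exOut c e ih | allIn c e ih =>
    obtain ⟨τ, h1, h2, h3, h4⟩ := ih r hr σ
    exact exec_op h1 h2 h4 (by simp only [Op.eval, eval, h3])
  | conj e f ihe ihf | disj e f ihe ihf =>
    obtain ⟨ρ, h1, h2, h3, h4⟩ := ihe r hr σ
    obtain ⟨τ, h5, h6, h7, h8⟩ := ihf (r + 1) (by omega) ρ
    rw [view_eq hr h4, h2] at h7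
    have h9 := h8 r (by omega)
    refine ⟨_, .seq h1 (.seq h5 (.op τ r _)), h6.trans h2, ?_, fun j hj => ?_⟩
    · simp only [Op.eval, eval, Function.update_self, h7, h9, h3]
    · simp only [Function.update_of_ne hj.ne]
      rw [h8 j (by omega), h4 j hj]

/-- Assignment of the value of an expression to a program variable. -/
def assign (r : Fin 16) (e : Expr) : Prog :=
  .seq (e.compile 16) (.op r (.disj 16 16))

end Expr

/-- The value is completed in scratch space before being copied, at the price of one step, so `e`
may mention `r` itself. -/
theorem Runs.assign {m n : ℕ} {β : Fin 16 → BDD m n} {k : ℕ}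
    {Q : (Fin 16 → BDD m n) → ℕ → Prop} {r : Fin 16} {e : Expr}
    (h : Q (Function.update β r (e.eval β k)) k) : Runs (e.assign r) (e.cost + 1) β k Q := by
  rintro σ rfl rfl
  obtain ⟨τ, h1, h2, h3, h4⟩ := e.exec_compile 16 le_rfl σ
  refine ⟨_, _, .seq h1 (.op τ r _), le_rfl, ?_⟩
  convert h using 1
  · funext j
    by_cases hj : j = r
    · subst hj
      simp [Store.view, Op.eval, h3]
    · have : (j : ℕ) ≠ r := fun h => hj (Fin.ext h)
      simp [Store.view, this, hj, h4 j (by omega)]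
  · simp [h2]

namespace Expr

/-- Quantification over all the variables of one copy. -/
def ex (c : Fin 3) (e : Expr) : Expr := .exIn c (.exOut c e)

/-- Replacement of the variables of the copy `c` by those of the copy `d`. -/
def subst (c d : Fin 3) (e : Expr) : Expr := .ex c (.conj e (.conj (.eqIn c d) (.eqOut c d)))

variable {m n : ℕ} {β : Fin 16 → BDD m n} {k : ℕ} {v : Val m n} {c d : Fin 3} {e f : Expr}

theorem mem_reg {a : Fin 16} : v ∈ (reg a).eval β k ↔ v ∈ β a := Iff.rfl

theorem mem_neg : v ∈ (neg e).eval β k ↔ v ∉ e.eval β k := Iff.rfl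

theorem mem_conj : v ∈ (conj e f).eval β k ↔ v ∈ e.eval β k ∧ v ∈ f.eval β k := Iff.rfl

theorem mem_disj : v ∈ (disj e f).eval β k ↔ v ∈ e.eval β k ∨ v ∈ f.eval β k := Iff.rfl

theorem mem_exOut : v ∈ (exOut c e).eval β k ↔
    ∃ o : Output n, Function.update v c ((v c).1, o) ∈ e.eval β k := Iff.rfl

theorem mem_exIn : v ∈ (exIn c e).eval β k ↔
    ∃ i : Input m, Function.update v c (i, (v c).2) ∈ e.eval β k := Iff.rfl

theorem mem_allIn : v ∈ (allIn c e).eval β k ↔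
    ∀ i : Input m, Function.update v c (i, (v c).2) ∈ e.eval β k := Iff.rfl

theorem mem_ex : v ∈ (ex c e).eval β k ↔ ∃ s, Function.update v c s ∈ e.eval β k := by
  simp [ex, eval]

/-- The equalities pin the quantified copy `c` to copy `d`, which the quantifier leaves untouched
because `d ≠ c`. -/
theorem mem_subst (h : d ≠ c) :
    v ∈ (subst c d e).eval β k ↔ Function.update v c (v d) ∈ e.eval β k := by
  simp only [subst, mem_ex, eval, Set.mem_ofPred_eq, Function.update_self,
    Function.update_of_ne h]
  constructor
  · rintro ⟨s, h1, h2, h3⟩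
    rwa [← Prod.ext h2 h3]
  · intro h1
    exact ⟨_, h1, rfl, rfl⟩

end Expr

end WeakBuchi
namespace WeakBuchi

/-! ### Choosing outputs -/

open WeakBuchi.Expr in
/-- One round of the choice of outputs: wherever possible, output variable `k` becomes `false`. -/
def narrow (c : Fin 3) (r : Fin 16) : Expr :=
  conj (reg r) (disj (neg (varOut c)) (neg (exOut c (conj (reg r) (neg (varOut c))))))

/-- Replaces the relation in `r` by a function contained in it. -/
def choose (c : Fin 3) (r : Fin 16) : Prog :=
  .seq (.zero 0) (.loop Cond.isOut.test (.seq ((narrow c r).assign r) (.inc 0)))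

/-- `key` extracts what the choice may depend on: state and next input for moves, the initial input
for initial outputs. After `k` rounds the candidates left for a key agree on the first `k`
variables, and some candidate survives because `false` is imposed only where a candidate has it. -/
theorem Runs.choose {m n : ℕ} {c : Fin 3} {r : Fin 16} {β : Fin 16 → BDD m n} {k : ℕ}
    {Q : (Fin 16 → BDD m n) → ℕ → Prop} {κ : Type} (key : Val m n → κ)
    (hkey : ∀ v o, key (Function.update v c ((v c).1, o)) = key v) (P : κ → Output n → Prop)
    (hP : ∀ x, ∃ o, P x o) (hr : ∀ v, v ∈ β r ↔ P (key v) (v c).2)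
    (hQ : ∀ f : κ → Output n, (∀ x, P x (f x)) → ∀ b : BDD m n,
      (∀ v, v ∈ b ↔ f (key v) = (v c).2) → ∀ k, Q (Function.update β r b) k) :
    Runs (choose c r) (1 + (n * (((narrow c r).cost + 1) + 1 + 1) + 1)) β k Q := by
  refine .seq (.zero ?_)
  let I : ℕ → (Fin 16 → BDD m n) → ℕ → Prop := fun j β' k => j + k = n ∧
    ∃ (b : BDD m n) (P' : κ → Output n → Prop), β' = Function.update β r b ∧
      (∀ v, v ∈ b ↔ P' (key v) (v c).2) ∧ (∀ x, ∃ o, P' x o) ∧ (∀ x o, P' x o → P x o) ∧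
      ∀ x o o', P' x o → P' x o' → ∀ l : Fin n, (l : ℕ) < k → o l = o' l
  refine (Runs.loop (c := ((narrow c r).cost + 1) + 1) (b := .isOut) I ?_ (j := n) ?_).mono
    le_rfl ?_
  · rintro j β' k ⟨hj, b, P', rfl, h1, h2, h3, h4⟩ hk
    change k < n at hk
    refine .seq (.assign (.inc ⟨j - 1, by omega, by omega, _,
      fun x o => P' x o ∧ (o ⟨k, hk⟩ = false ∨ ¬ ∃ o', P' x o' ∧ o' ⟨k, hk⟩ = false),
      Function.update_idem _ _ _, ?_, ?_, fun x o h => h3 x o h.1, ?_⟩))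
    · intro v
      simp [narrow, Expr.eval, hk, h1, hkey]
    · intro x
      by_cases h : ∃ o', P' x o' ∧ o' ⟨k, hk⟩ = false
      · obtain ⟨o, ho, hf⟩ := h
        exact ⟨o, ho, Or.inl hf⟩
      · obtain ⟨o, ho⟩ := h2 x
        exact ⟨o, ho, Or.inr h⟩
    · rintro x o o' ⟨ho, hf⟩ ⟨ho', hf'⟩ l hl
      rcases Nat.lt_succ_iff_lt_or_eq.1 hl with hl | hl
      · exact h4 x o o' ho ho' l hl
      · obtain rfl : l = ⟨k, hk⟩ := Fin.ext hl
        -- If the bits differ, the candidate with `false` refutes the clause that kept the other.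
        cases h5 : o ⟨k, hk⟩ <;> cases h6 : o' ⟨k, hk⟩ <;> simp_all
  · exact ⟨rfl, β r, P, by simp, hr, hP, fun _ _ h => h, fun _ _ _ _ _ l hl => by omega⟩
  · rintro β' k ⟨hk, j, hj, b, P', rfl, h1, h2, h3, h4⟩
    change ¬ k < n at hk
    choose f hf using h2
    refine hQ f (fun x => h3 x _ (hf x)) b (fun v => ?_) k
    rw [h1]
    constructor
    · exact fun h => funext fun l => h4 _ _ _ (hf _) h l (by omega)
    · exact fun h => h ▸ hf _

/-! ### The reachability relation -/

/-- Registers `0, …, 4` hold the game and the winning condition, register `15` holds `false`. -/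
structure Loaded {m n : ℕ} (G : GameStructure m n) (acc : Set (State m n))
    (β : Fin 16 → BDD m n) : Prop where
  initIn : ∀ v, v ∈ β 0 ↔ (v 0).1 ∈ G.initIn
  initOut : ∀ v, v ∈ β 1 ↔ v 0 ∈ G.initOut
  safeIn : ∀ v, v ∈ β 2 ↔ G.safeIn (v 0) (v 1).1
  safeOut : ∀ v, v ∈ β 3 ↔ G.safeOut (v 0) (v 1)
  accepting : ∀ v, v ∈ β 4 ↔ v 0 ∈ acc
  false : β 15 = ∅

/-- The BDD `R(X, X')` represents a relation. -/
def RepresentsRel {m n : ℕ} (b : BDD m n) (R : State m n → State m n → Prop) : Prop :=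
  ∀ v, v ∈ b ↔ R (v 0) (v 1)

section

variable {m n : ℕ} {G : GameStructure m n} {acc : Set (State m n)} {β : Fin 16 → BDD m n} {k : ℕ}

theorem loaded_initialStore (G : GameStructure m n) (acc : Set (State m n)) :
    Loaded G acc (G.initialStore acc).view :=
  ⟨fun _ => Iff.rfl, fun _ => Iff.rfl, fun _ => Iff.rfl, fun _ => Iff.rfl, fun _ => Iff.rfl, rfl⟩

theorem Loaded.update (h : Loaded G acc β) {r : Fin 16} (hr : 5 ≤ r ∧ r < 15) (b : BDD m n) :
    Loaded G acc (Function.update β r b) := by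
  have hne : ∀ a : Fin 16, a < 5 ∨ a = 15 → a ≠ r := by
    rintro a ha rfl
    omega
  constructor
  · rw [Function.update_of_ne (hne 0 (by decide))]; exact h.initIn
  · rw [Function.update_of_ne (hne 1 (by decide))]; exact h.initOut
  · rw [Function.update_of_ne (hne 2 (by decide))]; exact h.safeIn
  · rw [Function.update_of_ne (hne 3 (by decide))]; exact h.safeOut
  · rw [Function.update_of_ne (hne 4 (by decide))]; exact h.accepting
  · rw [Function.update_of_ne (hne 15 (by decide))]; exact h.false

open WeakBuchi.Expr in
/-- The relation in register `5`, extended by one edge. -/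
def extendPath : Expr :=
  disj (reg 5) (ex 2 (conj (subst 1 2 (reg 5)) (subst 0 2 (conj (reg 2) (reg 3)))))

open WeakBuchi.Expr in
/-- Puts the reachability relation of the game graph into register `5`. -/
def reach : Prog :=
  .seq ((conj (eqIn 0 1) (eqOut 0 1)).assign 5) (.seq (extendPath.assign 6)
    (.loop (Cond.ne 5 6).test (.seq ((reg 6).assign 5) (extendPath.assign 6))))

/-- Copy `X''` carries the intermediate state of the composition. -/
theorem eval_extendPath (h : Loaded G acc β) {R : State m n → State m n → Prop}
    (hR : RepresentsRel (β 5) R) : RepresentsRel (extendPath.eval β k)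
      (fun s t => R s t ∨ ∃ u, R s u ∧ G.Edge u t) := by
  intro v
  simp [extendPath, Expr.mem_disj, Expr.mem_ex, Expr.mem_conj, Expr.mem_subst, Expr.mem_reg,
    hR _, h.safeIn, h.safeOut, GameStructure.Edge]

/-- Register `6` is one edge ahead of register `5`, and equality means closure. Each row that is not
yet closed gains a state in every round, so the number of rounds is bounded by the length of one
row. -/
theorem Runs.reach (h : Loaded G acc β) {Q : (Fin 16 → BDD m n) → ℕ → Prop}
    (hQ : ∀ b b' k, RepresentsRel b (Relation.ReflTransGen G.Edge) →
      Q (Function.update (Function.update β 5 b) 6 b') k) :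
    Runs reach (4 + ((extendPath.cost + 1) + (Fintype.card (State m n) *
      ((2 + (extendPath.cost + 1)) + 1) + 1))) β k Q := by
  classical
  let I : ℕ → (Fin 16 → BDD m n) → ℕ → Prop := fun j β' _ =>
    ∃ (b b' : BDD m n) (R : State m n → State m n → Prop),
      β' = Function.update (Function.update β 5 b) 6 b' ∧ RepresentsRel b R ∧
      RepresentsRel b' (fun s t => R s t ∨ ∃ u, R s u ∧ G.Edge u t) ∧
      (∀ s, R s s) ∧ (∀ s t, R s t → Relation.ReflTransGen G.Edge s t) ∧
      -- The second alternative holds initially with `j = N`, since a row of the identity has one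
      -- element.
      ∀ s, (∀ u t, R s u → G.Edge u t → R s t) ∨
        Fintype.card (State m n) < {t | R s t}.ncard + j
  refine .seq (.assign (.seq (.assign ((Runs.loop (b := .ne 5 6) I ?_
    (j := Fintype.card (State m n)) ?_).mono le_rfl ?_))))
  · rintro j β' k ⟨b, b', R, rfl, h1, h2, h3, h4, h5⟩ hne
    let R' : State m n → State m n → Prop := fun s t => R s t ∨ ∃ u, R s u ∧ G.Edge u t
    refine .seq (.assign (.assign ?_))
    have hne' : ∃ s t, R' s t ∧ ¬ R s t := by
      by_contra! hcon
      refine hne ?_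
      simp only [Function.update_self, ne_eq, Fin.reduceEq, not_false_eq_true,
        Function.update_of_ne]
      ext v
      rw [h1, h2]
      exact ⟨Or.inl, hcon _ _⟩
    obtain ⟨s, t, hs, hst⟩ := hne'
    have hj : 0 < j := by
      rcases h5 s with hc | hc
      · rcases hs with hs | ⟨u, hu, hut⟩
        · exact absurd hs hst
        · exact absurd (hc u t hu hut) hst
      · have : {t | R s t}.ncard < Fintype.card (State m n) := by
          rw [← Nat.card_eq_fintype_card]
          exact Set.ncard_lt_card fun h => hst (h ▸ Set.mem_univ t : t ∈ {t | R s t})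
        omega
    have hb : (Expr.reg 6).eval (Function.update (Function.update β 5 b) 6 b') k = b' := by
      simp [Expr.eval]
    rw [hb]
    refine ⟨j - 1, by omega, b', extendPath.eval
      (Function.update (Function.update (Function.update β 5 b) 6 b') 5 b') k, R', ?_, h2,
      eval_extendPath (acc := acc) (R := R') ?_ ?_,
      fun s => Or.inl (h3 s), ?_, ?_⟩
    rotate_left
    · exact ((h.update (by decide) _).update (by decide) _).update (by decide) _
    · rw [Function.update_self]; exact h2
    · rintro s t (hR | ⟨u, hR, hE⟩)
      · exact h4 s t hR
      · exact (h4 s u hR).tail hE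
    · intro s
      by_cases hc : ∀ u t, R s u → G.Edge u t → R s t
      · left
        rintro u t (hu | ⟨w, hw, hwu⟩) hE
        · exact Or.inl (hc u t hu hE)
        · exact Or.inl (hc u t (hc w u hw hwu) hE)
      · right
        have h6 := (h5 s).resolve_left hc
        push Not at hc
        obtain ⟨u, t, hu, hE, ht⟩ := hc
        have : {t | R s t}.ncard < {t | R' s t}.ncard := by
          refine Set.ncard_lt_ncard ⟨fun t ht => Or.inl ht, fun hsub => ht ?_⟩
          exact hsub (show R' s t from Or.inr ⟨u, hu, hE⟩)
        omega
    · funext r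
      by_cases h5 : r = 5 <;> by_cases h6 : r = 6 <;> simp [h5, h6]
  · refine ⟨_, _, fun s t => s = t, rfl, ?_, eval_extendPath (h.update (by decide) _) ?_,
      fun _ => rfl, fun s t h => h ▸ .refl, fun s => Or.inr ?_⟩
    · intro v
      simp [Expr.eval, Prod.ext_iff]
    · intro v
      simp [Expr.eval, Prod.ext_iff]
    · simp
  · rintro β' k ⟨hne, j, b, b', R, rfl, h1, h2, h3, h4, h5⟩
    refine hQ b b' k fun v => ?_
    have heq : b = b' := by simpa [Cond.Holds] using hne
    rw [h1]
    refine ⟨h4 _ _, fun hR => ?_⟩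
    generalize v 0 = s at hR
    generalize v 1 = t at hR
    induction hR with
    | refl => exact h3 _
    | @tail u t _ hE ih =>
      -- Equality of the two BDDs is applied at a valuation with `s` in copy `0` and `t` in copy
      -- `1`.
      have key : (Function.update (fun _ => t : Val m n) 0 s) ∈ b' := by
        rw [h2]
        exact Or.inr ⟨u, by simpa using ih, by simpa using hE⟩
      rw [← heq, h1] at key
      simpa using key

end

end WeakBuchi
namespace WeakBuchi

/-! ### The winning region -/

section

open WeakBuchi.Expr

/-- The states from which the system can force the play into the set in register `6`. -/
def cpreExpr : Expr :=
  allIn 1 (disj (neg (reg 2)) (exOut 1 (conj (reg 3) (subst 0 1 (reg 6)))))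

/-- The states from which the environment can force the play into the set in register `7`. -/
def epreExpr : Expr :=
  exIn 1 (conj (reg 2) (neg (exOut 1 (conj (reg 3) (neg (subst 0 1 (reg 7)))))))

/-- The states trapped in the set denoted by `e`. -/
def trappedExpr (e : Expr) : Expr :=
  conj (reg 9) (conj e (neg (ex 1 (conj (reg 5) (subst 0 1 (conj (reg 9) (neg e)))))))

/-- The moves in register `8`, extended by those from the states in register `10` into the set
denoted by `e`. -/
def movesExpr (e : Expr) : Expr :=
  disj (reg 8) (conj (reg 10) (conj (reg 3) (subst 0 1 e)))

/-- Treats the states in which a player can force the play into a decided state. -/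
def attractStep : Prog := (movesExpr (reg 6)).assign 8

/-- Treats the undecided states that are trapped in `acc` or in its complement. -/
def trapStep : Prog :=
  .seq ((trappedExpr (reg 4)).assign 10) (.seq ((trappedExpr (neg (reg 4))).assign 11)
    ((movesExpr (disj (reg 6) (reg 10))).assign 8))

/-- One round: decides at least one further state.  Registers `6` and `7` hold the states decided
for the system and for the environment, `9` the undecided ones, and `8` the moves of the system. -/
def solveStep : Prog :=
  .seq ((conj (reg 9) cpreExpr).assign 10) (.seq ((conj (reg 9) epreExpr).assign 11)
    (.seq ((disj (reg 10) (reg 11)).assign 12)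
      (.seq (.ite (Cond.ne 12 15).test attractStep trapStep)
        (.seq ((disj (reg 6) (reg 10)).assign 6) (.seq ((disj (reg 7) (reg 11)).assign 7)
          ((neg (disj (reg 6) (reg 7))).assign 9))))))

/-- Decides all states. -/
def solve : Prog :=
  .seq ((reg 15).assign 6) (.seq ((neg (reg 15)).assign 9)
    (.loop (Cond.ne 9 15).test solveStep))

end

variable {m n : ℕ} {G : GameStructure m n} {acc W L : Set (State m n)}
  {T : State m n → State m n → Prop} {β : Fin 16 → BDD m n} {k : ℕ}

theorem eval_cpreExpr (h : Loaded G acc β) (hW : RepresentsSet (β 6) W) :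
    RepresentsSet (cpreExpr.eval β k) (G.cpre W) := by
  intro v
  simp [cpreExpr, GameStructure.cpre, Expr.mem_disj, Expr.mem_allIn, Expr.mem_exOut, Expr.mem_neg,
    Expr.mem_conj, Expr.mem_subst, Expr.mem_reg, hW _, h.safeIn, h.safeOut, imp_iff_not_or]

theorem eval_epreExpr (h : Loaded G acc β) (hL : RepresentsSet (β 7) L) :
    RepresentsSet (epreExpr.eval β k) (G.epre L) := by
  intro v
  simp [epreExpr, GameStructure.epre, Expr.mem_exIn, Expr.mem_exOut, Expr.mem_neg,
    Expr.mem_conj, Expr.mem_subst, Expr.mem_reg, hL _, h.safeIn, h.safeOut]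

theorem eval_trappedExpr (hR : RepresentsRel (β 5) (Relation.ReflTransGen G.Edge))
    (hU : RepresentsSet (β 9) {s | s ∉ W ∧ s ∉ L}) {e : Expr} {Q : Set (State m n)}
    (he : RepresentsSet (e.eval β k) Q) :
    RepresentsSet ((trappedExpr e).eval β k) (trapped G W L Q) := by
  intro v
  simp [trappedExpr, trapped, Expr.mem_ex, Expr.mem_neg, Expr.mem_conj, Expr.mem_subst,
    Expr.mem_reg, hR _, hU _, he _]

theorem eval_movesExpr (h : Loaded G acc β) (hT : RepresentsRel (β 8) T) {A V : Set (State m n)}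
    (hA : RepresentsSet (β 10) A) {e : Expr} (he : RepresentsSet (e.eval β k) V) :
    RepresentsRel ((movesExpr e).eval β k) (fun s t => T s t ∨ (s ∈ A ∧ G.safeOut s t ∧ t ∈ V)) := by
  intro v
  simp [movesExpr, Expr.mem_disj, Expr.mem_conj, Expr.mem_subst, Expr.mem_reg, hT _, hA _, he _,
    h.safeOut]

theorem RepresentsSet.eq_empty_iff {b : BDD m n} {A : Set (State m n)} (h : RepresentsSet b A) :
    b = ∅ ↔ A = ∅ := by
  simp only [Set.eq_empty_iff_forall_notMem]
  constructor
  · intro hb s hs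
    exact hb (fun _ => s) ((h _).2 hs)
  · intro hA v hv
    exact hA _ ((h v).1 hv)

/-- The memory between two rounds. -/
structure Solving (G : GameStructure m n) (acc W L : Set (State m n))
    (T : State m n → State m n → Prop) (β : Fin 16 → BDD m n) : Prop extends Loaded G acc β where
  reach : RepresentsRel (β 5) (Relation.ReflTransGen G.Edge)
  win : RepresentsSet (β 6) W
  lose : RepresentsSet (β 7) L
  moves : RepresentsRel (β 8) T
  undecided : RepresentsSet (β 9) {s | s ∉ W ∧ s ∉ L}
  decidedBy : DecidedBy G acc W L T

/-- The memory before the states in the registers `10` and `11` are decided. -/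
structure Deciding (G : GameStructure m n) (acc W L A B : Set (State m n))
    (T : State m n → State m n → Prop) (β : Fin 16 → BDD m n) : Prop extends Loaded G acc β where
  reach : RepresentsRel (β 5) (Relation.ReflTransGen G.Edge)
  win : RepresentsSet (β 6) W
  lose : RepresentsSet (β 7) L
  moves : RepresentsRel (β 8) T
  addWin : RepresentsSet (β 10) A
  addLose : RepresentsSet (β 11) B
  decidedBy : DecidedBy G acc (W ∪ A) (L ∪ B) T
  exists_new : ∃ s, (s ∉ W ∧ s ∉ L) ∧ (s ∈ A ∨ s ∈ B)

/-- A bound for the number of steps of `attractStep` and of `trapStep`. -/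
def branchCost : ℕ :=
  ((trappedExpr (.reg 4)).cost + 1) + (((trappedExpr (.neg (.reg 4))).cost + 1) +
    ((movesExpr (.disj (.reg 6) (.reg 10))).cost + 1))

theorem Solving.runs_attractStep (h : Solving G acc W L T β) {A B : Set (State m n)}
    (hA : A = {s | (s ∉ W ∧ s ∉ L) ∧ s ∈ G.cpre W}) (hB : B = {s | (s ∉ W ∧ s ∉ L) ∧ s ∈ G.epre L})
    (h10 : RepresentsSet (β 10) A) (h11 : RepresentsSet (β 11) B) (hne : ∃ s, s ∈ A ∨ s ∈ B) :
    Runs attractStep branchCost β k fun β' _ => ∃ A B T', Deciding G acc W L A B T' β' := by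
  refine (Runs.assign (Q := fun β' _ => ∃ A B T', Deciding G acc W L A B T' β') ?_).mono
    (by simp [branchCost, movesExpr, Expr.subst, Expr.ex, Expr.cost]; omega) fun _ _ h => h
  have hm := eval_movesExpr (k := k) h.toLoaded h.moves h10 (e := .reg 6) h.win
  refine ⟨A, B, _, ⟨h.toLoaded.update (by decide) _, ?_, ?_, ?_, ?_, ?_, ?_,
    h.decidedBy.attract hA hB, ?_⟩⟩
  · simpa using h.reach
  · simpa using h.win
  · simpa using h.lose
  · simpa using hm
  · simpa using h10
  · simpa using h11
  · obtain ⟨s, hs⟩ := hne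
    refine ⟨s, ?_, hs⟩
    subst hA hB
    exact hs.elim And.left And.left

theorem Solving.runs_trapStep (h : Solving G acc W L T β) (hw : G.IsWeak acc)
    (hU : ∃ s, s ∉ W ∧ s ∉ L) (hA : ∀ s, s ∉ W → s ∉ L → s ∉ G.cpre W)
    (hB : ∀ s, s ∉ W → s ∉ L → s ∉ G.epre L) :
    Runs trapStep branchCost β k fun β' _ => ∃ A B T', Deciding G acc W L A B T' β' := by
  refine .seq (.assign (.seq (.assign (.assign ?_))))
  have h10 := eval_trappedExpr (k := k) h.reach h.undecided (e := .reg 4) h.accepting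
  generalize (trappedExpr (.reg 4)).eval β k = b₁ at h10 ⊢
  have h11 : RepresentsSet ((trappedExpr (.neg (.reg 4))).eval (Function.update β 10 b₁) k)
      (trapped G W L accᶜ) := by
    refine eval_trappedExpr (by simpa using h.reach) (by simpa using h.undecided) fun v => ?_
    simp [Expr.mem_neg, Expr.mem_reg, h.accepting]
  generalize (trappedExpr (.neg (.reg 4))).eval (Function.update β 10 b₁) k = b₂ at h11 ⊢
  have hl : Loaded G acc (Function.update (Function.update β 10 b₁) 11 b₂) :=
    (h.toLoaded.update (by decide) _).update (by decide) _
  have hm := eval_movesExpr (k := k) hl (T := T) (A := trapped G W L acc)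
    (V := W ∪ trapped G W L acc) (e := .disj (.reg 6) (.reg 10)) (by simpa using h.moves)
    (by simpa using h10) fun v => by
      simp [Expr.mem_disj, Expr.mem_reg, h.win _, h10 _]
  obtain ⟨u, hu⟩ := hU
  obtain ⟨s, hs⟩ := hw.exists_trapped hu
  refine ⟨_, _, _, ⟨hl.update (by decide) _, ?_, ?_, ?_, ?_, ?_, ?_, h.decidedBy.trap hA hB,
    s, hs.elim And.left And.left, hs⟩⟩
  · simpa using h.reach
  · simpa using h.win
  · simpa using h.lose
  · simpa using hm
  · simpa using h10
  · simpa using h11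

/-- The nested updates are the last three assignments of `solveStep`; `exists_new` makes the
decrease strict. -/
theorem Deciding.solving {A B : Set (State m n)} (h : Deciding G acc W L A B T β) :
    ∃ W' L' T', Solving G acc W' L' T'
      (let β₁ := Function.update β 6 ((Expr.disj (.reg 6) (.reg 10)).eval β k)
       let β₂ := Function.update β₁ 7 ((Expr.disj (.reg 7) (.reg 11)).eval β₁ k)
       Function.update β₂ 9 ((Expr.neg (.disj (.reg 6) (.reg 7))).eval β₂ k)) ∧
      {s | s ∉ W' ∧ s ∉ L'}.ncard < {s | s ∉ W ∧ s ∉ L}.ncard := by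
  refine ⟨W ∪ A, L ∪ B, T, ⟨?_, ?_, fun v => ?_, fun v => ?_, ?_, fun v => ?_, h.decidedBy⟩, ?_⟩
  · exact ((h.toLoaded.update (by decide) _).update (by decide) _).update (by decide) _
  · simpa using h.reach
  · simp [Expr.eval, h.win _, h.addWin _]
  · simp [Expr.eval, h.lose _, h.addLose _]
  · simpa using h.moves
  · simp [Expr.eval, h.win _, h.addWin _, h.lose _, h.addLose _]
  · obtain ⟨s, hs, hs'⟩ := h.exists_new
    refine Set.ncard_lt_ncard ⟨fun t ht => ⟨fun h => ht.1 (Or.inl h), fun h => ht.2 (Or.inl h)⟩,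
      fun hsub => ?_⟩
    have := hsub hs
    exact hs'.elim (fun h => this.1 (Or.inr h)) (fun h => this.2 (Or.inr h))

/-- A bound for the number of steps of `solveStep`. -/
def roundCost : ℕ :=
  (cpreExpr.cost + 3) + ((epreExpr.cost + 3) + (4 + ((branchCost + 1) + (4 + (4 + 5)))))

theorem Solving.runs_solveStep (h : Solving G acc W L T β) (hw : G.IsWeak acc)
    (hU : β 9 ≠ β 15) :
    Runs solveStep roundCost β k fun β' _ => ∃ W' L' T', Solving G acc W' L' T' β' ∧
      {s | s ∉ W' ∧ s ∉ L'}.ncard < {s | s ∉ W ∧ s ∉ L}.ncard := by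
  have hU' : ∃ s, s ∉ W ∧ s ∉ L := by
    rw [h.false, ne_eq, h.undecided.eq_empty_iff] at hU
    exact Set.nonempty_iff_ne_empty.2 hU
  refine (Runs.seq (.assign (.seq (.assign (.seq (.assign (.seq ((Runs.ite (c := branchCost)
    (Q := fun β' _ => ∃ A B T', Deciding G acc W L A B T' β') ?_ ?_).mono le_rfl ?_)))))))).mono
    (c₁ := ((Expr.conj (.reg 9) cpreExpr).cost + 1) + (((Expr.conj (.reg 9) epreExpr).cost + 1) +
      (((Expr.disj (.reg 10) (.reg 11)).cost + 1) + ((branchCost + 1) +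
      (((Expr.disj (.reg 6) (.reg 10)).cost + 1) + (((Expr.disj (.reg 7) (.reg 11)).cost + 1) +
      ((Expr.neg (.disj (.reg 6) (.reg 7))).cost + 1)))))))
    (by simp [roundCost, Expr.cost]; omega) fun _ _ h => h
  -- The tail of the round is common to both branches and is verified once.
  rotate_right
  · rintro β' k ⟨A, B, T', h'⟩
    exact .seq (.assign (.seq (.assign (.assign h'.solving))))
  all_goals
    have h10 : RepresentsSet ((Expr.conj (.reg 9) cpreExpr).eval β k)
        {s | (s ∉ W ∧ s ∉ L) ∧ s ∈ G.cpre W} := fun v =>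
      and_congr (h.undecided v) (eval_cpreExpr h.toLoaded h.win v)
    generalize (Expr.conj (.reg 9) cpreExpr).eval β k = b₁ at h10 ⊢
    have h11 : RepresentsSet ((Expr.conj (.reg 9) epreExpr).eval (Function.update β 10 b₁) k)
        {s | (s ∉ W ∧ s ∉ L) ∧ s ∈ G.epre L} := fun v =>
      and_congr (by simpa [Expr.mem_reg] using h.undecided v)
        (eval_epreExpr (h.toLoaded.update (by decide) _) (by simpa using h.lose) v)
    generalize (Expr.conj (.reg 9) epreExpr).eval (Function.update β 10 b₁) k = b₂ at h11 ⊢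
    have h12 : RepresentsSet ((Expr.disj (.reg 10) (.reg 11)).eval
        (Function.update (Function.update β 10 b₁) 11 b₂) k)
        ({s | (s ∉ W ∧ s ∉ L) ∧ s ∈ G.cpre W} ∪ {s | (s ∉ W ∧ s ∉ L) ∧ s ∈ G.epre L}) := fun v =>
      or_congr (by simpa [Expr.mem_reg] using h10 v) (by simpa [Expr.mem_reg] using h11 v)
    generalize (Expr.disj (.reg 10) (.reg 11)).eval
        (Function.update (Function.update β 10 b₁) 11 b₂) k = b₃ at h12 ⊢
    have hs : Solving G acc W L T
        (Function.update (Function.update (Function.update β 10 b₁) 11 b₂) 12 b₃) :=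
      ⟨((h.toLoaded.update (by decide) _).update (by decide) _).update (by decide) _,
        by simpa using h.reach, by simpa using h.win, by simpa using h.lose,
        by simpa using h.moves, by simpa using h.undecided, h.decidedBy⟩
    intro hc
    simp only [Cond.Holds, hs.false, Function.update_self, ne_eq, h12.eq_empty_iff] at hc
  · refine hs.runs_attractStep rfl rfl (by simpa using h10) (by simpa using h11) ?_
    exact Set.nonempty_iff_ne_empty.2 hc
  -- An empty register `12` says exactly that attraction is saturated, as trapping requires.
  · rw [not_not, Set.union_empty_iff, Set.eq_empty_iff_forall_notMem,
      Set.eq_empty_iff_forall_notMem] at hc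
    exact hs.runs_trapStep hw hU' (fun s h1 h2 h3 => hc.1 s ⟨⟨h1, h2⟩, h3⟩)
      (fun s h1 h2 h3 => hc.2 s ⟨⟨h1, h2⟩, h3⟩)

/-- The number of undecided states bounds the remaining rounds. `solve` does not initialise
registers `7` and `8`, so they must start out as `false`. -/
theorem runs_solve (hl : Loaded G acc β) (hw : G.IsWeak acc)
    (h5 : RepresentsRel (β 5) (Relation.ReflTransGen G.Edge)) (h7 : β 7 = ∅) (h8 : β 8 = ∅) :
    Runs solve (2 + (3 + (Fintype.card (State m n) * (roundCost + 1) + 1))) β k fun β' _ =>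
      ∃ W L T, Solving G acc W L T β' ∧ ∀ s, s ∈ W ∨ s ∈ L := by
  refine .seq (.assign (.seq (.assign ((Runs.loop (b := .ne 9 15) (c := roundCost)
    (j := {s : State m n | s ∉ (∅ : Set (State m n)) ∧ s ∉ (∅ : Set (State m n))}.ncard)
    (fun j β' _ => ∃ W L T, Solving G acc W L T β' ∧ {s | s ∉ W ∧ s ∉ L}.ncard = j)
    ?_ ?_).mono ?_ ?_))))
  · rintro j β' k ⟨W, L, T, h, rfl⟩ hne
    refine (h.runs_solveStep hw hne).mono le_rfl ?_
    rintro β'' - ⟨W', L', T', h', hlt⟩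
    exact ⟨_, hlt, W', L', T', h', rfl⟩
  · refine ⟨∅, ∅, fun _ _ => False, ⟨(hl.update (by decide) _).update (by decide) _, by simpa using h5,
      fun v => ?_, fun v => ?_, fun v => ?_, fun v => ?_, decidedBy_empty G acc⟩, rfl⟩
    · simp [Expr.eval, hl.false]
    · simp [h7]
    · simp [h8]
    · simp [Expr.eval, hl.false]
  · have := Set.ncard_le_card {s : State m n | s ∉ (∅ : Set (State m n)) ∧ s ∉ (∅ : Set (State m n))}
    rw [Nat.card_eq_fintype_card] at this
    exact Nat.add_le_add_right (Nat.mul_le_mul_right _ this) 1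
  · rintro β' k ⟨hc, j, W, L, T, h, -⟩
    refine ⟨W, L, T, h, fun s => ?_⟩
    simp only [Cond.Holds, h.false, ne_eq, not_not, h.undecided.eq_empty_iff] at hc
    by_contra hs
    exact Set.eq_empty_iff_forall_notMem.1 hc s (not_or.1 hs)

/-! ### The algorithm -/

section

open WeakBuchi.Expr

/-- The initial choices of the system that lead to the states in register `6`. -/
def initExpr : Expr := conj (reg 1) (reg 6)

/-- Extends the relation denoted by `e` to one that is total in the outputs of copy `c`. -/
def totalExpr (c : Fin 3) (e : Expr) : Expr := disj e (neg (exOut c e))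

/-- Realizability. -/
def realizableExpr : Expr := allIn 0 (disj (neg (reg 0)) (exOut 0 initExpr))

/-- Computes the outputs of the algorithm once all states have been decided. -/
def extract : Prog :=
  .seq ((totalExpr 1 (reg 8)).assign 2) (.seq (choose 1 2)
    (.seq ((totalExpr 0 initExpr).assign 3) (.seq (choose 0 3)
      (.seq (realizableExpr.assign 1) ((reg 6).assign 0)))))

/-- The algorithm for weak Büchi games. -/
def weakBuchi : Prog := .seq reach (.seq solve extract)

end

/-- The outputs of the algorithm. -/
def Correct (G : GameStructure m n) (acc : Set (State m n)) (β : Fin 16 → BDD m n) : Prop :=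
  RepresentsSet (β 0) (G.winningRegion acc) ∧
  (G.Realizable acc → β 1 = Set.univ) ∧ (¬ G.Realizable acc → β 1 = ∅) ∧
  ∃ (f : State m n → Input m → Output n) (g : Input m → Output n),
    RepresentsStrategy (β 2) f ∧ RepresentsInitial (β 3) g ∧
    (∀ s ∈ G.winningRegion acc, G.WinsFrom acc (memoryless g f) s) ∧
    (G.Realizable acc → G.IsWinning acc (memoryless g f))

theorem GameStructure.Realizable.exists_output (h : G.Realizable acc) :
    ∀ i ∈ G.initIn, ∃ o, (i, o) ∈ G.initOut ∧ (i, o) ∈ G.winningRegion acc := by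
  obtain ⟨f, hf⟩ := h
  exact fun i hi => ⟨_, (hf i hi).1, f, (hf i hi).2⟩

/-- Supplies the totality needed by `Runs.choose`: where `P` offers nothing, every output is
allowed. -/
theorem exists_total {κ : Type*} (P : κ → Output n → Prop) (x : κ) :
    ∃ o, P x o ∨ ¬ ∃ o, P x o := by
  by_cases h : ∃ o, P x o
  · exact h.imp fun _ => Or.inl
  · exact ⟨fun _ => false, Or.inr h⟩

/-- The game is realizable iff every legal initial input has a legal initial output leading into
`W`. The input registers are overwritten in an order in which each is read for the last time no
later than the assignment that replaces it. -/
theorem Solving.runs_extract (h : Solving G acc W L T β) (hU : ∀ s, s ∈ W ∨ s ∈ L) :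
    Runs extract (((totalExpr 1 (.reg 8)).cost + 1) +
      ((1 + (n * (((narrow 1 2).cost + 1) + 1 + 1) + 1)) + (((totalExpr 0 initExpr).cost + 1) +
      ((1 + (n * (((narrow 0 3).cost + 1) + 1 + 1) + 1)) + ((realizableExpr.cost + 1) + 2)))))
      β k fun β' _ => Correct G acc β' := by
  obtain ⟨rank, b, hd, -⟩ := h.decidedBy
  have hreg := hd.winningRegion_eq hU
  refine .seq (.assign (.seq (.choose (fun v => (v 0, (v 1).1)) (by simp)
    (fun x o => T x.1 (x.2, o) ∨ ¬ ∃ o, T x.1 (x.2, o)) (exists_total _) ?_ ?_)))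
  · intro v
    simp [totalExpr, Expr.mem_disj, Expr.mem_neg, Expr.mem_exOut, Expr.mem_reg, h.moves _]
  intro f hf b₂ h2 k
  rw [Function.update_idem]
  refine .seq (.assign (.seq (.choose (fun v => (v 0).1) (by simp)
    (fun i o => ((i, o) ∈ G.initOut ∧ (i, o) ∈ W) ∨ ¬ ∃ o, (i, o) ∈ G.initOut ∧ (i, o) ∈ W)
    (exists_total fun i o => (i, o) ∈ G.initOut ∧ (i, o) ∈ W) ?_ ?_)))
  · intro v
    simp [totalExpr, initExpr, Expr.mem_disj, Expr.mem_neg, Expr.mem_exOut, Expr.mem_conj,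
      Expr.mem_reg, h.initOut, h.win _]
  intro g hg b₃ h3 k
  rw [Function.update_idem]
  have hr : ∀ v, v ∈ realizableExpr.eval (Function.update (Function.update β 2 b₂) 3 b₃) k ↔
      ∀ i ∈ G.initIn, ∃ o, (i, o) ∈ G.initOut ∧ (i, o) ∈ W := by
    intro v
    simp [realizableExpr, initExpr, Expr.mem_disj, Expr.mem_neg, Expr.mem_exOut, Expr.mem_conj,
      Expr.mem_allIn, Expr.mem_reg, h.initIn, h.initOut, h.win _, imp_iff_not_or]
  have hwins : ∀ s ∈ W, G.WinsFrom acc (memoryless g fun s i => f (s, i)) s := fun s hs =>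
    -- A choice from the totalised relation is a genuine move of `T` wherever one exists.
    hd.winsFrom (fun s i ho => (hf (s, i)).resolve_right (not_not.2 ho)) g hs
  have hwin : (∀ i ∈ G.initIn, ∃ o, (i, o) ∈ G.initOut ∧ (i, o) ∈ W) →
      G.IsWinning acc (memoryless g fun s i => f (s, i)) := fun ho i hi => by
    have := (hg i).resolve_right (not_not.2 (ho i hi))
    exact ⟨this.1, hwins _ this.2⟩
  have hiff : (∀ i ∈ G.initIn, ∃ o, (i, o) ∈ G.initOut ∧ (i, o) ∈ W) ↔ G.Realizable acc :=
    ⟨fun ho => ⟨_, hwin ho⟩, fun hr => hreg ▸ hr.exists_output⟩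
  rw [hiff] at hr hwin
  refine .seq (.assign (.assign ⟨fun v => ?_, fun hR => ?_, fun hR => ?_, fun s i => f (s, i), g,
    fun v => ?_, fun v => ?_, hreg ▸ hwins, hwin⟩))
  · simp [Expr.eval, h.win _, hreg]
  · simpa [Set.eq_univ_iff_forall, hr] using hR
  · simpa [Set.eq_empty_iff_forall_notMem, hr] using hR
  · simp [h2]
  · simp [h3]

theorem runs_weakBuchi (hw : G.IsWeak acc) :
    Runs weakBuchi (1000 * Fintype.card (State m n)) (G.initialStore acc).view k
      fun β' _ => Correct G acc β' := by
  have hl := loaded_initialStore G acc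
  refine (Runs.seq (.reach hl fun b b' k hb => .seq ((runs_solve
    ((hl.update (by decide) _).update (by decide) _) hw (by simpa using hb) (by simp; rfl)
      (by simp; rfl)).mono le_rfl fun β' k ⟨W, L, T, h, hU⟩ => h.runs_extract hU))).mono ?_
    fun _ _ h => h
  -- This bound absorbs the `n` rounds of each choice of outputs and, as it forces at least one
  -- state, the additive constants. The factor `1000` is not sharp.
  have h1 : n < Fintype.card (State m n) := by
    have : 2 ^ n ≤ 2 ^ m * 2 ^ n := Nat.le_mul_of_pos_left _ (by positivity)
    have := Nat.lt_two_pow_self (n := n)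
    simp
    omega
  generalize Fintype.card (State m n) = N at h1
  simp [extendPath, roundCost, branchCost, cpreExpr, epreExpr, trappedExpr, movesExpr, totalExpr,
    initExpr, narrow, realizableExpr, Expr.subst, Expr.ex, Expr.cost]
  omega

end WeakBuchi

/-- One symbolic program solves all weak Büchi games, in a number of steps linear in the number of
states.  It halts with register `0` holding the winning region of the system, register `1` the
constant `true` or `false` according to realizability, and registers `2` and `3` a memoryless
strategy that wins from the whole winning region and, with its initial outputs, is a winning
strategy for the game whenever there is one. -/
theorem mainTheorem3 :
    ∃ (P : WeakBuchi.Prog) (C : ℕ), ∀ (m n : ℕ) (G : WeakBuchi.GameStructure m n)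
      (acc : Set (WeakBuchi.State m n)), G.IsWeak acc →
      ∃ (t : ℕ) (τ : WeakBuchi.Store m n),
        WeakBuchi.Exec P (G.initialStore acc) t τ ∧
        t ≤ C * Fintype.card (WeakBuchi.State m n) ∧
        WeakBuchi.RepresentsSet (τ.bdd 0) (G.winningRegion acc) ∧
        (G.Realizable acc → τ.bdd 1 = Set.univ) ∧
        (¬ G.Realizable acc → τ.bdd 1 = ∅) ∧
        ∃ (f : WeakBuchi.State m n → WeakBuchi.Input m → WeakBuchi.Output n)
          (g : WeakBuchi.Input m → WeakBuchi.Output n),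
          WeakBuchi.RepresentsStrategy (τ.bdd 2) f ∧
          WeakBuchi.RepresentsInitial (τ.bdd 3) g ∧
          (∀ s ∈ G.winningRegion acc, G.WinsFrom acc (WeakBuchi.memoryless g f) s) ∧
          (G.Realizable acc → G.IsWinning acc (WeakBuchi.memoryless g f)) := by
  refine ⟨WeakBuchi.weakBuchi, 1000, fun m n G acc hw => ?_⟩
  obtain ⟨t, τ, h1, h2, h3⟩ := WeakBuchi.runs_weakBuchi (k := 0) hw _ rfl rfl
  exact ⟨t, τ, h1, h2, h3⟩
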